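/- A TSP instance of size $n$ is the complete undirected graph $K_n=(V,E)$ on $n$ vertices together with a weight function $c\colon E\to\mathbb{R}$. A tour is a Hamiltonian cycle of $K_n$, and its weight is the sum of the weights of its edges. For an integer $k$, a $k$-swap removes a set $E_1$ of at most $k$ edges from a tour $\tau$ and adds a set $E_2\subseteq E$ with $|E_2|=|E_1|$; it is improving if the result is a tour of strictly smaller weight. The $k$-opt algorithm starts from some initial tour and, as long as the current tour admits an improving $k$-swap, performs one (chosen by an arbitrary pivot rule); it stops when no improving $k$-swap exists. **Theorem.** For every integer $k\ge 5$, TSP/$k$-opt has the all-exp property: there are constants $c_0>1$ and $C>0$ (which may depend on $k$) such that for every $N$ there are a TSP instance with $n\ge N$ vertices and an initial tour for which, whatever pivot rule is used, the $k$-opt algorithm performs at least $C\,c_0^{\,n}$ iterations before it reaches a local optimum. Equivalently, every directed path in the transition graph of this instance (whose arcs are the improving $k$-swaps) from the initial tour to a sink has length at least $C\,c_0^{\,n}$. -/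

import Mathlib

/-- A (minimization) local search problem.  Every instance has a size and finitely many feasible
solutions, whose own size is bounded by a polynomial in the size of the instance; every solution
has an objective value and a set of neighbours. -/
structure LocalSearchProblem where
  Instance : Type
  size : Instance → ℕ
  Solution : Instance → Type
  finite_solution : ∀ I, Finite (Solution I)
  solutionSize : ∀ I, Solution I → ℕ
  solutionSize_le : ∃ p : Polynomial ℕ, ∀ I (s : Solution I), solutionSize I s ≤ p.eval (size I)
  objective : ∀ I, Solution I → ℝ
  neighborhood : ∀ I, Solution I → Set (Solution I)

namespace LocalSearchProblem

/-- The arcs of the transition graph of `I`: one iteration of the standard local search algorithm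
may move from `s` to `s'`, a neighbour of `s` with strictly better objective value. -/
def Step (P : LocalSearchProblem) (I : P.Instance) (s s' : P.Solution I) : Prop :=
  s' ∈ P.neighborhood I s ∧ P.objective I s' < P.objective I s

/-- No neighbour of `s` has a strictly better objective value. -/
def IsLocalOpt (P : LocalSearchProblem) (I : P.Instance) (s : P.Solution I) : Prop :=
  ∀ s' ∈ P.neighborhood I s, P.objective I s ≤ P.objective I s'

/-- `p 0, p 1, …, p ℓ` is a complete execution, with exactly `ℓ` iterations, of the standard local
search algorithm started at `s`: every move is an improving one, and the execution ends in a
local optimum.  (The values `p i` with `i > ℓ` play no role.)  The executions under all possible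
pivot rules are exactly these sequences. -/
structure IsExecution (P : LocalSearchProblem) (I : P.Instance) (s : P.Solution I)
    (ℓ : ℕ) (p : ℕ → P.Solution I) : Prop where
  start : p 0 = s
  step : ∀ i < ℓ, P.Step I (p i) (p (i + 1))
  stop_localOpt : P.IsLocalOpt I (p ℓ)

/-- The all-exp property: there are constants `c > 1` and `C > 0` and pairs `(I, s)` of an
instance and an initial solution, with instances of arbitrarily large size (so infinitely many
pairs), such that every execution of the standard local search algorithm started at `s`
takes at least `C * c ^ (size of I)` iterations, whichever pivot rule is used. -/
def AllExp (P : LocalSearchProblem) : Prop :=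
  ∃ c : ℝ, 1 < c ∧ ∃ C : ℝ, 0 < C ∧
    ∀ N : ℕ, ∃ I : P.Instance, N ≤ P.size I ∧ ∃ s : P.Solution I,
      ∀ (ℓ : ℕ) (p : ℕ → P.Solution I), P.IsExecution I s ℓ p → C * c ^ P.size I ≤ (ℓ : ℝ)

end LocalSearchProblem

namespace TSP

/-- An instance of the traveling salesman problem: the complete graph on `n` vertices with real
edge weights.  The edges are the non-loops of `Sym2 (Fin n)`; weights of loops are never used. -/
structure Inst where
  n : ℕ
  weight : Sym2 (Fin n) → ℝ

/-- `T` is the edge set of a Hamiltonian cycle of the complete graph on `n` vertices. -/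
def IsTour (n : ℕ) (T : Finset (Sym2 (Fin n))) : Prop :=
  ∃ (v : Fin n) (p : (⊤ : SimpleGraph (Fin n)).Walk v v),
    p.IsHamiltonianCycle ∧ p.edges.toFinset = T

/-- Tours, as edge sets. -/
def Tour (n : ℕ) : Type := {T : Finset (Sym2 (Fin n)) // IsTour n T}

/-- The weight of a tour is the sum of the weights of its edges. -/
noncomputable def Inst.tourWeight (I : Inst) (τ : Tour I.n) : ℝ := ∑ e ∈ τ.1, I.weight e

/-- `τ'` arises from `τ` by performing a `k`-swap `(E₁, E₂)`: at most `k` edges `E₁` of `τ` are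
removed and equally many edges `E₂` of the complete graph are added. -/
def IsKSwap (k : ℕ) {n : ℕ} (τ τ' : Tour n) : Prop :=
  ∃ E₁ E₂ : Finset (Sym2 (Fin n)), E₁ ⊆ τ.1 ∧ E₂ ⊆ (⊤ : SimpleGraph (Fin n)).edgeFinset ∧
    E₁.card = E₂.card ∧ E₁.card ≤ k ∧ τ'.1 = (τ.1 \ E₁) ∪ E₂

/-- The local search problem TSP/`k`-opt: the neighbours of a tour are the tours obtained from it
by an improving `k`-swap.  The size of an instance is its number of vertices. -/
noncomputable def kOpt (k : ℕ) : LocalSearchProblem where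
  Instance := Inst
  size I := I.n
  Solution I := Tour I.n
  finite_solution I := by unfold Tour; infer_instance
  solutionSize _ τ := τ.1.card
  solutionSize_le := by
    refine ⟨Polynomial.X ^ 2, fun I τ => ?_⟩
    have h1 : Fintype.card (Sym2 (Fin I.n)) ≤ Fintype.card (Fin I.n × Fin I.n) :=
      Fintype.card_le_of_surjective (fun q => s(q.1, q.2))
        (fun e => by induction e with | _ a b => exact ⟨(a, b), rfl⟩)
    have h2 : τ.1.card ≤ Fintype.card (Sym2 (Fin I.n)) := Finset.card_le_univ _
    simp only [Fintype.card_prod, Fintype.card_fin] at h1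
    rw [Polynomial.eval_pow, Polynomial.eval_X, sq]
    exact h2.trans h1
  objective I τ := I.tourWeight τ
  neighborhood I τ := {τ' | IsKSwap k τ τ' ∧ I.tourWeight τ' < I.tourWeight τ}

end TSP

/-! The instance simulates a chain of `n + 1` gears. Gear `i` has a phase `θ i` in `ZMod p`, gear 0
is fixed at 0, and each gear should stand at twice its predecessor's phase; it may be behind by `lag
θ i ≤ 2`. A state is a directed Hamiltonian cycle through `n + 1` layers of `p` nodes: it enters
layer `i` at `θ i`, runs once around, and pays `3 ^ (n - i) * lag θ i` for passing on. Splitting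
each node into an exit and an entry joined by a link of very negative weight makes the graph
undirected, and all tours that are light enough are state tours (`exists_state_of_tourWeight_lt`).

Unrolling the lags gives an integer `phase`. It is `-2 ^ n` at the last gear of the start state and
0 at a local optimum: while some lag is nonzero, advancing the gear after the last such lag is an
improving 3-swap (`isState_update`, `card_sdiff_update_le`).

A `k`-swap changes at most `k` gears (`card_filter_ne_le`). The deviation of integer phases at most
doubles plus 2 per gear, and is a multiple of `p` at each unchanged gear. For `p ≥ 2 ^ (k + 2)` that
multiple is 0, so the last phase moves by less than `2 ^ (k + 1)` (`abs_phase_sub_le`). Hence every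
run has at least `2 ^ n / 2 ^ (k + 1)` steps, on only `2 * p * (n + 1)` vertices. -/

namespace TSP

open SimpleGraph

/-! ### Hamiltonian cycles: construction from sequences, degree and connectivity. -/

/-- A sequence of vertices without immediate repetitions is the support of a walk in the complete
graph. -/
theorem exists_walk_of_seq {V : Type*} (f : ℕ → V) (k : ℕ) (hf : ∀ i < k, f i ≠ f (i + 1)) :
    ∃ w : (⊤ : SimpleGraph V).Walk (f 0) (f k),
      w.support = (List.range (k + 1)).map f ∧
      w.edges = (List.range k).map fun i => s(f i, f (i + 1)) := by
  induction k with
  | zero => exact ⟨Walk.nil, by simp, by simp⟩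
  | succ k ih =>
    obtain ⟨w, hs, he⟩ := ih fun i hi => hf i (by omega)
    have hadj : (⊤ : SimpleGraph V).Adj (f k) (f (k + 1)) := hf k (by omega)
    refine ⟨w.concat hadj, ?_, ?_⟩
    · rw [Walk.support_concat, hs, List.range_succ (n := k + 1), List.map_append]
      simp
    · rw [Walk.edges_concat, he, List.range_succ (n := k), List.map_append]
      simp

theorem isTour_of_seq {n : ℕ} (hn : 3 ≤ n) (f : ℕ → Fin n) (hinj : Set.InjOn f (Set.Iio n))
    (hper : f n = f 0) :
    IsTour n ((Finset.range n).image fun i => s(f i, f (i + 1))) := by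
  obtain ⟨m, rfl⟩ : ∃ m, n = m + 1 := ⟨n - 1, by omega⟩
  have hne : ∀ i < m, f i ≠ f (i + 1) := fun i hi h => by
    have := hinj (Set.mem_Iio.2 (by omega)) (Set.mem_Iio.2 (by omega)) h
    omega
  obtain ⟨w, hs, he⟩ := exists_walk_of_seq f m hne
  have hadj : (⊤ : SimpleGraph (Fin (m + 1))).Adj (f m) (f 0) := fun h => by
    have := hinj (Set.mem_Iio.2 (by omega)) (Set.mem_Iio.2 (by omega)) h
    omega
  refine ⟨f m, Walk.cons hadj w, ?_, ?_⟩
  · rw [Walk.isHamiltonianCycle_iff_isCycle_and_length_eq, Walk.cons_isCycle_iff]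
    refine ⟨⟨?_, ?_⟩, ?_⟩
    · rw [Walk.isPath_def, hs]
      refine List.Nodup.map_on ?_ List.nodup_range
      intro a ha b hb hab
      exact hinj (by simpa using ha) (by simpa using hb) hab
    · rw [he]
      simp only [List.mem_map, List.mem_range, not_exists, not_and]
      intro i hi h
      rw [Sym2.eq_iff] at h
      rcases h with ⟨h1, -⟩ | ⟨h1, h2⟩
      · have := hinj (Set.mem_Iio.2 (by omega)) (Set.mem_Iio.2 (by omega)) h1
        omega
      · have := hinj (Set.mem_Iio.2 (by omega)) (Set.mem_Iio.2 (by omega)) h1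
        have := hinj (Set.mem_Iio.2 (by omega)) (Set.mem_Iio.2 (by omega)) h2
        omega
    · have := congrArg List.length he
      simp only [Walk.length_edges, List.length_map, List.length_range] at this
      simp [this]
  · ext e
    rw [Walk.edges_cons, he]
    simp only [List.toFinset_cons, Finset.mem_insert, List.mem_toFinset, List.mem_map,
      List.mem_range, Finset.mem_image, Finset.mem_range]
    constructor
    · rintro (rfl | ⟨i, hi, rfl⟩)
      · exact ⟨m, by omega, by rw [hper]⟩
      · exact ⟨i, by omega, rfl⟩
    · rintro ⟨i, hi, rfl⟩
      rcases Nat.lt_succ_iff_lt_or_eq.1 hi with h | rfl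
      · exact Or.inr ⟨i, h, rfl⟩
      · exact Or.inl (by rw [hper])

variable {n : ℕ} {T : Finset (Sym2 (Fin n))}

theorem IsTour.card_eq (h : IsTour n T) : T.card = n := by
  obtain ⟨v, p, hp, rfl⟩ := h
  rw [List.toFinset_card_of_nodup hp.isCycle.isTrail.edges_nodup, Walk.length_edges, hp.length_eq,
    Fintype.card_fin]

theorem IsTour.subset_edgeFinset (h : IsTour n T) : T ⊆ (⊤ : SimpleGraph (Fin n)).edgeFinset := by
  obtain ⟨v, p, hp, rfl⟩ := h
  intro e he
  rw [mem_edgeFinset]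
  exact p.edges_subset_edgeSet (List.mem_toFinset.1 he)

theorem IsTour.ncard_neighbors (h : IsTour n T) (x : Fin n) : {y | s(x, y) ∈ T}.ncard = 2 := by
  obtain ⟨v, p, hp, rfl⟩ := h
  rw [← hp.isCycle.ncard_neighborSet_toSubgraph_eq_two (hp.mem_support x)]
  congr 1
  ext y
  rw [Subgraph.mem_neighborSet, ← Subgraph.mem_edgeSet, Walk.mem_edges_toSubgraph]
  simp

/-- This is connectivity of the tour, in the form that excludes subtours. -/
theorem IsTour.mem_of_closed (h : IsTour n T) {S : Set (Fin n)}
    (hS : ∀ x y, s(x, y) ∈ T → x ∈ S → y ∈ S) {a : Fin n} (ha : a ∈ S) (b : Fin n) : b ∈ S := by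
  obtain ⟨v, p, hp, rfl⟩ := h
  have key : ∀ {u w : Fin n} (q : (⊤ : SimpleGraph (Fin n)).Walk u w),
      (∀ e ∈ q.edges, e ∈ p.edges) → (u ∈ S ↔ w ∈ S) := by
    intro u w q
    induction q with
    | nil => simp
    | @cons u x w hux q ih =>
      intro hq
      rw [← ih fun e he => hq e (by simp [he])]
      have hmem : s(u, x) ∈ p.edges := hq _ (by simp)
      exact ⟨fun hu => hS u x (by simpa using hmem) hu,
        fun hx => hS x u (by simpa [Sym2.eq_swap] using hmem) hx⟩
  have hv : ∀ x, v ∈ S ↔ x ∈ S := fun x =>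
    key (p.takeUntil x (hp.mem_support x)) fun e he => p.edges_takeUntil_subset_edges _ he
  exact (hv b).1 ((hv a).2 ha)

end TSP

namespace TSP

open Finset

/-! ### From directed to undirected tours by doubling the nodes. -/

section Doubling

variable {Q : Type*} {N : ℕ} (e : Q ⊕ Q ≃ Fin N)

/-- Each node `q` of a directed graph is split into an exit `e (inl q)` and an entry `e (inr q)`.
The edge `arcEdge e q r` represents the arc from `q` to `r`, and `arcEdge e q q` links the two
copies of `q`. -/
def arcEdge (q r : Q) : Sym2 (Fin N) := s(e (Sum.inl q), e (Sum.inr r))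

/-- Edge weights on the doubled node set: arcs and links have weight `c`, other edges `B`. -/
def arcWeight (c : Q → Q → ℝ) (B : ℝ) : Sym2 (Fin N) → ℝ :=
  Sym2.lift ⟨fun x y => match e.symm x, e.symm y with
    | Sum.inl q, Sum.inr r => c q r
    | Sum.inr r, Sum.inl q => c q r
    | _, _ => B, fun x y => by
      rcases hx : e.symm x <;> rcases hy : e.symm y <;> simp only [hx, hy]⟩

@[simp]
theorem arcWeight_arcEdge (c : Q → Q → ℝ) (B : ℝ) (q r : Q) :
    arcWeight e c B (arcEdge e q r) = c q r := by
  simp [arcWeight, arcEdge]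

theorem arcEdge_inj {q r q' r' : Q} : arcEdge e q r = arcEdge e q' r' ↔ q = q' ∧ r = r' := by
  simp [arcEdge]

theorem exists_arcEdge_of_arcWeight_ne {c : Q → Q → ℝ} {B : ℝ} {x : Sym2 (Fin N)}
    (h : arcWeight e c B x ≠ B) : ∃ q r, x = arcEdge e q r := by
  induction x with | _ x y
  obtain ⟨x, rfl⟩ := e.surjective x
  obtain ⟨y, rfl⟩ := e.surjective y
  rcases x with q | q <;> rcases y with r | r
  · simp [arcWeight] at h
  · exact ⟨q, r, rfl⟩
  · exact ⟨r, q, Sym2.eq_swap⟩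
  · simp [arcWeight] at h

variable [Fintype Q]

/-- The links of all nodes. -/
def linkEdges : Finset (Sym2 (Fin N)) := univ.image fun q => arcEdge e q q

/-- The edges of the doubled node set that represent a successor function `σ`. -/
def succEdges (σ : Q → Q) : Finset (Sym2 (Fin N)) :=
  linkEdges e ∪ univ.image fun q => arcEdge e q (σ q)

theorem card_linkEdges : (linkEdges e).card = Fintype.card Q := by
  rw [linkEdges, card_image_of_injective _ fun q r h => ((arcEdge_inj e).1 h).1, card_univ]

theorem arcEdge_mem_linkEdges {q r : Q} : arcEdge e q r ∈ linkEdges e ↔ r = q := by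
  simp only [linkEdges, mem_image, mem_univ, true_and, arcEdge_inj]
  grind

theorem arcEdge_mem_succEdges {σ : Q → Q} {q r : Q} :
    arcEdge e q r ∈ succEdges e σ ↔ r = q ∨ r = σ q := by
  simp only [succEdges, mem_union, arcEdge_mem_linkEdges, mem_image, mem_univ, true_and,
    arcEdge_inj]
  grind

theorem sum_arcWeight_succEdges {c : Q → Q → ℝ} {B : ℝ} (hc : ∀ q, c q q = -B) {σ : Q → Q}
    (hσ : ∀ q, σ q ≠ q) :
    ∑ x ∈ succEdges e σ, arcWeight e c B x = -B * Fintype.card Q + ∑ q, c q (σ q) := by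
  rw [succEdges, sum_union, linkEdges, sum_image fun q _ r _ h => ((arcEdge_inj e).1 h).1,
    sum_image fun q _ r _ h => ((arcEdge_inj e).1 h).1]
  · simp [hc, mul_comm]
  · rw [disjoint_left]
    simp only [linkEdges, mem_image, mem_univ, true_and, not_exists]
    rintro x ⟨q, rfl⟩ r h
    obtain ⟨rfl, h⟩ := (arcEdge_inj e).1 h
    exact hσ _ h

theorem card_eq_two_mul_of_equiv {Q : Type*} [Fintype Q] {N : ℕ} (e : Q ⊕ Q ≃ Fin N) :
    N = 2 * Fintype.card Q := by
  simpa [two_mul] using (Fintype.card_congr e).symm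

theorem isTour_succEdges (hQ : 2 ≤ Fintype.card Q) (σ : Q → Q) (q₀ : Q)
    (hsurj : ∀ q, ∃ t < Fintype.card Q, σ^[t] q₀ = q) (hper : σ^[Fintype.card Q] q₀ = q₀) :
    IsTour N (succEdges e σ) := by
  have hN := card_eq_two_mul_of_equiv e
  have hinj : ∀ a < Fintype.card Q, ∀ b < Fintype.card Q, σ^[a] q₀ = σ^[b] q₀ → a = b := by
    let g : Fin (Fintype.card Q) → Q := fun t => σ^[t] q₀
    have hg : Function.Surjective g := fun q => by
      obtain ⟨t, ht, h⟩ := hsurj q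
      exact ⟨⟨t, ht⟩, h⟩
    have hg' : Function.Injective g :=
      hg.injective_of_finite (Fintype.equivFin Q).symm
    intro a ha b hb h
    exact congrArg Fin.val (@hg' ⟨a, ha⟩ ⟨b, hb⟩ h)
  -- The tour alternates: each node's entry at an even position, then its exit.
  let f : ℕ → Fin N := fun i =>
    if i % 2 = 0 then e (Sum.inr (σ^[i / 2] q₀)) else e (Sum.inl (σ^[i / 2] q₀))
  have hf0 : ∀ t, f (2 * t) = e (Sum.inr (σ^[t] q₀)) := fun t => by simp [f]
  have hf1 : ∀ t, f (2 * t + 1) = e (Sum.inl (σ^[t] q₀)) := fun t => by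
    have h1 : (2 * t + 1) / 2 = t := by omega
    simp [f, h1, Nat.add_mod]
  have hfinj : Set.InjOn f (Set.Iio N) := by
    intro a ha b hb hab
    rw [Set.mem_Iio] at ha hb
    rcases Nat.even_or_odd' a with ⟨s, rfl | rfl⟩ <;> rcases Nat.even_or_odd' b with ⟨t, rfl | rfl⟩
      <;> simp only [hf0, hf1, EmbeddingLike.apply_eq_iff_eq, Sum.inl.injEq, Sum.inr.injEq,
        reduceCtorEq] at hab
    · rw [hinj s (by omega) t (by omega) hab]
    · rw [hinj s (by omega) t (by omega) hab]
  have htour := isTour_of_seq (by omega) f hfinj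
    ((congrArg f hN).trans (by rw [hf0, hper]; exact (hf0 0).symm))
  convert htour using 1
  ext x
  simp only [succEdges, linkEdges, mem_union, mem_image, mem_univ, true_and, mem_range]
  constructor
  · rintro (⟨q, rfl⟩ | ⟨q, rfl⟩) <;> obtain ⟨t, ht, rfl⟩ := hsurj q
    · exact ⟨2 * t, by omega, by rw [hf0, hf1, arcEdge, Sym2.eq_swap]⟩
    · refine ⟨2 * t + 1, by omega, ?_⟩
      rw [show 2 * t + 1 + 1 = 2 * (t + 1) by ring, hf0, hf1, arcEdge, Function.iterate_succ_apply']
  · rintro ⟨i, hi, rfl⟩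
    rcases Nat.even_or_odd' i with ⟨t, rfl | rfl⟩
    · exact Or.inl ⟨σ^[t] q₀, by rw [hf0, hf1, arcEdge, Sym2.eq_swap]⟩
    · refine Or.inr ⟨σ^[t] q₀, ?_⟩
      rw [show 2 * t + 1 + 1 = 2 * (t + 1) by ring, hf0, hf1, arcEdge, Function.iterate_succ_apply']

theorem eq_of_ncard_eq_two {α : Type*} {s : Set α} (hs : s.ncard = 2) {a b c : α} (ha : a ∈ s)
    (hb : b ∈ s) (hc : c ∈ s) (hab : a ≠ b) (hac : a ≠ c) : b = c := by
  obtain ⟨x, y, -, rfl⟩ := Set.ncard_eq_two.1 hs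
  simp only [Set.mem_insert_iff, Set.mem_singleton_iff] at ha hb hc
  grind

/-- If the links have weight `-B` and all other edges have weights in `[0, B]`, then a tour whose
weight is small enough contains all links and no edge of weight `B`. -/
theorem linkEdges_subset_of_sum_lt {c : Q → Q → ℝ} {B : ℝ} (hB : 0 ≤ B) (hc : ∀ q, c q q = -B)
    (hc0 : ∀ q r, q ≠ r → 0 ≤ c q r) {T : Finset (Sym2 (Fin N))}
    (hw : ∑ x ∈ T, arcWeight e c B x < -B * Fintype.card Q + B) :
    linkEdges e ⊆ T ∧ ∀ x ∈ T, x ∉ linkEdges e → arcWeight e c B x < B := by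
  have hlink : ∀ x ∈ linkEdges e, arcWeight e c B x = -B := by
    simp only [linkEdges, mem_image, mem_univ, true_and]
    rintro x ⟨q, rfl⟩
    simp [hc]
  have hpos : ∀ x, x ∉ linkEdges e → 0 ≤ arcWeight e c B x := by
    intro x hx
    by_cases h : arcWeight e c B x = B
    · rwa [h]
    · obtain ⟨q, r, rfl⟩ := exists_arcEdge_of_arcWeight_ne e h
      rw [arcEdge_mem_linkEdges] at hx
      simpa using hc0 q r (Ne.symm hx)
  have hsplit : ∑ x ∈ T, arcWeight e c B x =
      -B * (T ∩ linkEdges e).card + ∑ x ∈ T \ linkEdges e, arcWeight e c B x := by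
    rw [← sum_inter_add_sum_sdiff T (linkEdges e),
      sum_congr rfl fun x hx => hlink x (mem_inter.1 hx).2]
    simp [mul_comm]
  have hrest : ∀ x ∈ T \ linkEdges e, 0 ≤ arcWeight e c B x := fun x hx =>
    hpos x (mem_sdiff.1 hx).2
  have hcard : (T ∩ linkEdges e).card ≤ Fintype.card Q :=
    (card_le_card inter_subset_right).trans_eq (card_linkEdges e)
  -- A single missing link already costs `B`, and non-links cannot compensate because their weights
  -- are nonnegative.
  have hcard' : (T ∩ linkEdges e).card = Fintype.card Q := by
    by_contra hne
    have h1 : ((T ∩ linkEdges e).card : ℝ) + 1 ≤ Fintype.card Q := by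
      exact_mod_cast lt_of_le_of_ne hcard hne
    have h2 := sum_nonneg hrest
    nlinarith
  refine ⟨?_, fun x hx hxl => ?_⟩
  · rw [← eq_of_subset_of_card_le (inter_subset_right : T ∩ linkEdges e ⊆ linkEdges e)
      (by rw [hcard', card_linkEdges])]
    exact inter_subset_left
  · have h1 := single_le_sum hrest (mem_sdiff.2 ⟨hx, hxl⟩)
    rw [hsplit, hcard'] at hw
    linarith

/-- All links are present, so degree 2 leaves each exit and each entry exactly one further edge.
These edges form a permutation, and connectivity of the tour makes it a single cycle. -/
theorem IsTour.exists_perm_of_sum_lt {c : Q → Q → ℝ} {B : ℝ} (hB : 0 ≤ B)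
    (hc : ∀ q, c q q = -B) (hc0 : ∀ q r, q ≠ r → 0 ≤ c q r) {T : Finset (Sym2 (Fin N))}
    (hT : IsTour N T) (hw : ∑ x ∈ T, arcWeight e c B x < -B * Fintype.card Q + B) :
    ∃ σ : Equiv.Perm Q, T = succEdges e σ ∧ (∀ q, σ q ≠ q) ∧ (∀ q, c q (σ q) < B) ∧
      ∀ S : Set Q, (∀ q, q ∈ S ↔ σ q ∈ S) → S.Nonempty → S = Set.univ := by
  obtain ⟨hlink, hlight⟩ := linkEdges_subset_of_sum_lt e hB hc hc0 hw
  have hself : ∀ q, arcEdge e q q ∈ T := fun q => hlink ((arcEdge_mem_linkEdges e).2 rfl)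
  have harc : ∀ x ∈ T, ∃ q r, x = arcEdge e q r := fun x hx => by
    by_cases h : x ∈ linkEdges e
    · obtain ⟨q, -, rfl⟩ := mem_image.1 h
      exact ⟨q, q, rfl⟩
    · exact exists_arcEdge_of_arcWeight_ne e (hlight x hx h).ne
  have hex : ∀ q, ∃ r, r ≠ q ∧ arcEdge e q r ∈ T := fun q => by
    obtain ⟨a, ha, hne⟩ := Set.exists_ne_of_one_lt_ncard
      (by rw [hT.ncard_neighbors (e (Sum.inl q))]; norm_num) (e (Sum.inr q))
    obtain ⟨q', r, h⟩ := harc _ ha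
    rw [arcEdge, Sym2.eq_iff] at h
    simp only [EmbeddingLike.apply_eq_iff_eq, Sum.inl.injEq, reduceCtorEq, false_and,
      or_false] at h
    obtain ⟨rfl, rfl⟩ := h
    exact ⟨r, fun h => hne (by rw [h]), ha⟩
  choose σ hσne hσmem using hex
  have huniq : ∀ q r, arcEdge e q r ∈ T → r ≠ q → r = σ q := fun q r h hne => by
    have := eq_of_ncard_eq_two (hT.ncard_neighbors (e (Sum.inl q))) (hself q) h (hσmem q)
      (by simpa using hne.symm) (by simpa using (hσne q).symm)
    simpa using this
  have hinj : Function.Injective σ := fun q q' h => by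
    have := eq_of_ncard_eq_two (hT.ncard_neighbors (e (Sum.inr (σ q))))
      (a := e (Sum.inl (σ q))) (b := e (Sum.inl q)) (c := e (Sum.inl q'))
      (by simpa [arcEdge, Sym2.eq_swap] using hself (σ q))
      (by simpa [arcEdge, Sym2.eq_swap] using hσmem q)
      (by simpa [arcEdge, Sym2.eq_swap, h] using hσmem q')
      (by simpa using hσne q) (by simpa [h] using hσne q')
    simpa using this
  have hTσ : T = succEdges e σ := by
    ext x
    constructor
    · intro hx
      obtain ⟨q, r, rfl⟩ := harc x hx
      rw [arcEdge_mem_succEdges]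
      by_cases h : r = q
      · exact Or.inl h
      · exact Or.inr (huniq q r hx h)
    · simp only [succEdges, mem_union, mem_image, mem_univ, true_and]
      rintro (hx | ⟨q, rfl⟩)
      · exact hlink hx
      · exact hσmem q
  refine ⟨Equiv.ofBijective σ (Finite.injective_iff_bijective.1 hinj), hTσ, hσne, fun q => ?_,
    fun S hS ⟨q₀, hq₀⟩ => ?_⟩
  · simpa using hlight _ (hσmem q) (by rw [arcEdge_mem_linkEdges]; exact hσne q)
  · have hcl := hT.mem_of_closed (S := {x | Sum.elim id id (e.symm x) ∈ S}) (a := e (Sum.inl q₀))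
      (by
        intro x y hxy hx
        obtain ⟨q, r, h⟩ := harc _ hxy
        rw [h, hTσ, arcEdge_mem_succEdges] at hxy
        have hqr : q ∈ S ↔ r ∈ S := by
          rcases hxy with rfl | rfl
          · rfl
          · exact hS q
        rw [arcEdge, Sym2.eq_iff] at h
        rcases h with ⟨rfl, rfl⟩ | ⟨rfl, rfl⟩
        · simpa using hqr.1 (by simpa using hx)
        · simpa using hqr.2 (by simpa using hx)) (by simpa using hq₀)
    exact Set.eq_univ_of_forall fun q => by simpa using hcl (e (Sum.inl q))

end Doubling

end TSP

namespace TSP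

open Finset

/-! ### The layered digraph and its Hamiltonian cycles. -/

section Layers

variable {n p : ℕ}

/-- The amount by which `θ (i + 1)` is behind `2 * θ i`. -/
def lag (θ : ℕ → ZMod p) (i : ℕ) : ℕ := (2 * θ i - θ (i + 1)).val

/-- A state of the counter: the phases of `n + 1` gears, the first of which is fixed. -/
def IsState (n : ℕ) (θ : ℕ → ZMod p) : Prop := θ 0 = 0 ∧ ∀ i < n, lag θ i ≤ 2

/-- The cyclic order on `n + 1` layers of `p` nodes that enters layer `i` at the node `θ i`, runs
once through the layer, and proceeds to the next layer. -/
def layerSucc (n : ℕ) (θ : ℕ → ZMod p) (q : Fin (n + 1) × ZMod p) : Fin (n + 1) × ZMod p :=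
  if q.2 + 1 = θ q.1 then (q.1 + 1, θ ((q.1 + 1 : Fin (n + 1)) : ℕ)) else (q.1, q.2 + 1)

theorem layerSucc_of_ne {θ : ℕ → ZMod p} {i : Fin (n + 1)} {j : ZMod p} (h : j + 1 ≠ θ i) :
    layerSucc n θ (i, j) = (i, j + 1) := by
  simp [layerSucc, h]

theorem layerSucc_of_eq {θ : ℕ → ZMod p} {i : Fin (n + 1)} {j : ZMod p} (h : j + 1 = θ i) :
    layerSucc n θ (i, j) = (i + 1, θ ((i + 1 : Fin (n + 1)) : ℕ)) := by
  simp [layerSucc, h]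

theorem val_add_one_of_val_lt {i : Fin (n + 1)} (h : (i : ℕ) < n) :
    ((i + 1 : Fin (n + 1)) : ℕ) = i + 1 := by
  rw [Fin.val_add_one, if_neg (fun h' => by simp [h'] at h)]

theorem layerSucc_iterate [NeZero p] (θ : ℕ → ZMod p) (i : Fin (n + 1)) {r : ℕ} (hr : r < p) :
    (layerSucc n θ)^[r] (i, θ i) = (i, θ i + r) := by
  induction r with
  | zero => simp
  | succ r ih =>
    rw [Function.iterate_succ_apply', ih (by omega), layerSucc_of_ne]
    · simp [add_assoc]
    · intro h
      rw [add_assoc, add_eq_left, ← Nat.cast_add_one, ZMod.natCast_eq_zero_iff] at h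
      exact absurd (Nat.le_of_dvd (by omega) h) (by omega)

theorem layerSucc_iterate_period [NeZero p] (θ : ℕ → ZMod p) (i : Fin (n + 1)) :
    (layerSucc n θ)^[p] (i, θ i) = (i + 1, θ ((i + 1 : Fin (n + 1)) : ℕ)) := by
  obtain ⟨r, hr⟩ : ∃ r, p = r + 1 := ⟨p - 1, by have := NeZero.pos p; omega⟩
  have h1 := layerSucc_iterate θ i (r := r) (by omega)
  have h2 : (r : ZMod p) + 1 = 0 := by
    rw [← Nat.cast_add_one, ← hr, ZMod.natCast_self]
  rw [congrArg (fun s => (layerSucc n θ)^[s]) hr, Function.iterate_succ_apply', h1,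
    layerSucc_of_eq (by rw [add_assoc, h2, add_zero])]

theorem layerSucc_iterate_mul [NeZero p] (θ : ℕ → ZMod p) (m : ℕ) :
    (layerSucc n θ)^[p * m] (0, θ 0) = (Fin.ofNat (n + 1) m, θ (Fin.ofNat (n + 1) m)) := by
  induction m with
  | zero => simp
  | succ m ih =>
    have h : Fin.ofNat (n + 1) m + 1 = Fin.ofNat (n + 1) (m + 1) := by
      ext; simp [Fin.val_add]
    rw [mul_add, mul_one, add_comm (p * m), Function.iterate_add_apply, ih, layerSucc_iterate_period, h]

theorem card_layers [NeZero p] : Fintype.card (Fin (n + 1) × ZMod p) = p * (n + 1) := by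
  rw [Fintype.card_prod, Fintype.card_fin, ZMod.card, mul_comm]

theorem isTour_layerSucc [NeZero p] (hp : 2 ≤ p) {N : ℕ}
    (e : (Fin (n + 1) × ZMod p) ⊕ (Fin (n + 1) × ZMod p) ≃ Fin N) (θ : ℕ → ZMod p) :
    IsTour N (succEdges e (layerSucc n θ)) := by
  refine isTour_succEdges e (by rw [card_layers]; nlinarith) _ (0, θ 0) ?_ ?_
  · rintro ⟨i, j⟩
    have hlt := ZMod.val_lt (j - θ i)
    -- The cycle spends `p` steps in each of the `i` earlier layers, then advances from `θ i` to
    -- `j`.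
    refine ⟨(j - θ i).val + p * i, ?_, ?_⟩
    · rw [card_layers]
      have := Nat.mul_le_mul_left p (Nat.succ_le_of_lt i.2)
      rw [Nat.succ_eq_add_one, mul_add] at this
      omega
    · rw [Function.iterate_add_apply, layerSucc_iterate_mul]
      simp only [Fin.ofNat_eq_cast, Fin.cast_val_eq_self]
      rw [layerSucc_iterate θ i hlt]
      simp
  · rw [card_layers, layerSucc_iterate_mul]
    simp

/-- The costs of the arcs of the layered digraph; `-B` for links, `B` for arcs not present. -/
noncomputable def arcCost (B : ℝ) (q r : Fin (n + 1) × ZMod p) : ℝ :=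
  if r = q then -B
  else if r = (q.1, q.2 + 1) then 0
  else if (r.1 : ℕ) = q.1 + 1 ∧ (2 * (q.2 + 1) - r.2).val ≤ 2 then
    3 ^ (n - q.1) * ((2 * (q.2 + 1) - r.2).val : ℝ)
  else if q.1 = Fin.last n ∧ r = (0, 0) then 0
  else B

theorem arcCost_self (B : ℝ) (q : Fin (n + 1) × ZMod p) : arcCost B q q = -B := by
  simp [arcCost]

theorem arcCost_nonneg {B : ℝ} (hB : 0 ≤ B) {q r : Fin (n + 1) × ZMod p} (h : q ≠ r) :
    0 ≤ arcCost B q r := by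
  rw [arcCost, if_neg h.symm]
  split_ifs <;> positivity

theorem arc_of_arcCost_lt {B : ℝ} {q r : Fin (n + 1) × ZMod p} (h : r ≠ q)
    (hlt : arcCost B q r < B) :
    r = (q.1, q.2 + 1) ∨ ((r.1 : ℕ) = q.1 + 1 ∧ (2 * (q.2 + 1) - r.2).val ≤ 2) ∨
      (q.1 = Fin.last n ∧ r = (0, 0)) := by
  rw [arcCost, if_neg h] at hlt
  split_ifs at hlt with h1 h2 h3
  · exact Or.inl h1
  · exact Or.inr (Or.inl h2)
  · exact Or.inr (Or.inr h3)
  · exact absurd hlt (lt_irrefl _)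

theorem fin_add_one_ne (hn : 1 ≤ n) (i : Fin (n + 1)) : i + 1 ≠ i := by
  intro h
  have := congrArg Fin.val h
  rw [Fin.val_add_one] at this
  split_ifs at this with h'
  · simp [h'] at this; omega
  · omega

theorem layerSucc_ne (hn : 1 ≤ n) (hp : 2 ≤ p) (θ : ℕ → ZMod p) (q : Fin (n + 1) × ZMod p) :
    layerSucc n θ q ≠ q := by
  have : Fact (1 < p) := ⟨hp⟩
  obtain ⟨i, j⟩ := q
  by_cases h : j + 1 = θ i
  · rw [layerSucc_of_eq h]
    intro h'
    exact fin_add_one_ne hn i (congrArg Prod.fst h')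
  · rw [layerSucc_of_ne h]
    intro h'
    exact one_ne_zero (add_eq_left.1 (congrArg Prod.snd h'))

/-- The energy of a state. -/
noncomputable def energy (n : ℕ) (θ : ℕ → ZMod p) : ℝ :=
  ∑ i ∈ range n, 3 ^ (n - i) * (lag θ i : ℝ)

/-- Arcs inside a layer and the closing arc to `(0, 0)` are free. Layer `i` is left from `θ i - 1`,
where the cost formula evaluates to the weighted lag. -/
theorem sum_arcCost_layerSucc [NeZero p] (hn : 1 ≤ n) (hp : 2 ≤ p) (B : ℝ) {θ : ℕ → ZMod p}
    (hθ : IsState n θ) : ∑ q, arcCost B q (layerSucc n θ q) = energy n θ := by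
  have : Fact (1 < p) := ⟨hp⟩
  have hinner : ∀ i : Fin (n + 1), ∑ j, arcCost B (i, j) (layerSucc n θ (i, j)) =
      arcCost B (i, θ i - 1) (i + 1, θ ((i + 1 : Fin (n + 1)) : ℕ)) := by
    intro i
    rw [sum_eq_single (θ i - 1), layerSucc_of_eq (sub_add_cancel _ _)]
    · intro j _ hj
      have hj' : j + 1 ≠ θ i := fun h => hj (eq_sub_of_add_eq h)
      have hne := layerSucc_ne hn hp θ (i, j)
      rw [layerSucc_of_ne hj'] at hne ⊢
      simp [arcCost, hne]
    · simp
  rw [Fintype.sum_prod_type, sum_congr rfl fun i _ => hinner i, Fin.sum_univ_castSucc, energy,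
    sum_range]
  have hlast : arcCost B (Fin.last n, θ (Fin.last n : ℕ) - 1)
      (Fin.last n + 1, θ ((Fin.last n + 1 : Fin (n + 1)) : ℕ)) = 0 := by
    have h0 : (0 : Fin (n + 1)) ≠ Fin.last n := by
      rw [Ne, Fin.ext_iff]; simp; omega
    rw [Fin.last_add_one, Fin.val_zero, hθ.1]
    simp [arcCost, h0]
  rw [hlast, add_zero]
  refine sum_congr rfl fun i _ => ?_
  have hne : i.castSucc + 1 ≠ i.castSucc := fin_add_one_ne hn _
  have hval : ((i.castSucc + 1 : Fin (n + 1)) : ℕ) = i + 1 :=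
    val_add_one_of_val_lt (by simp)
  have hl := hθ.2 i i.2
  rw [lag] at hl
  rw [hval, arcCost, if_neg fun h => hne (congrArg Prod.fst h),
    if_neg fun h => hne (congrArg Prod.fst h), if_pos ⟨hval, by simpa using hl⟩]
  simp [lag]

/-- `σ` runs through layer `i` starting from `a`. -/
def EntersAt (σ : Equiv.Perm (Fin (n + 1) × ZMod p)) (i : Fin (n + 1)) (a : ZMod p) : Prop :=
  ∀ j, σ (i, j) = (i, j + 1) ↔ j + 1 ≠ a

theorem EntersAt.eq {σ : Equiv.Perm (Fin (n + 1) × ZMod p)} {i : Fin (n + 1)} {a b : ZMod p}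
    (ha : EntersAt σ i a) (hb : EntersAt σ i b) : a = b := by
  by_contra hne
  have h := (hb (a - 1)).2 (by simpa using hne)
  exact (ha (a - 1)).1 h (by simp)

/-- The arcs of `σ` belong to the layered digraph. -/
def UsesLayerArcs (σ : Equiv.Perm (Fin (n + 1) × ZMod p)) : Prop :=
  ∀ q, σ q = (q.1, q.2 + 1) ∨
    (((σ q).1 : ℕ) = q.1 + 1 ∧ (2 * (q.2 + 1) - (σ q).2).val ≤ 2) ∨
    (q.1 = Fin.last n ∧ σ q = (0, 0))

/-- From outside, layer 0 can be entered only at `(0, 0)`, so every other node of it has its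
predecessor inside the layer. Were this also true of `(0, 0)`, the layer would be a closed subtour.
-/
theorem UsesLayerArcs.entersAt_zero {σ : Equiv.Perm (Fin (n + 1) × ZMod p)} (hn : 1 ≤ n)
    (h : UsesLayerArcs σ)
    (hconn : ∀ S : Set (Fin (n + 1) × ZMod p), (∀ q, q ∈ S ↔ σ q ∈ S) → S.Nonempty →
      S = Set.univ) : EntersAt σ 0 0 := by
  have hpred : ∀ q, (σ q).1 = 0 → σ q ≠ (0, 0) → q.1 = 0 ∧ σ q = (0, q.2 + 1) := by
    intro q h0 hne
    rcases h q with h1 | h1 | h1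
    · rw [h1] at h0
      exact ⟨h0, by rw [h1, ← h0]⟩
    · rw [h0] at h1
      simp at h1
    · exact absurd h1.2 hne
  have hint : ∀ j : ZMod p, j + 1 ≠ 0 → σ (0, j) = (0, j + 1) := by
    intro j hj
    obtain ⟨⟨i, j'⟩, hq⟩ := σ.surjective (0, j + 1)
    obtain ⟨h1, h2⟩ := hpred (i, j') (by rw [hq]) (by rw [hq]; simpa using hj)
    obtain rfl : i = 0 := h1
    rw [hq] at h2
    obtain rfl : j = j' := by simpa using h2
    exact hq
  intro j
  refine ⟨fun hj hj0 => ?_, hint j⟩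
  have hint' : ∀ j : ZMod p, σ (0, j) = (0, j + 1) := fun j' => by
    by_cases h' : j' + 1 = 0
    · rwa [show j' = j from add_right_cancel (h'.trans hj0.symm)]
    · exact hint j' h'
  have huniv := hconn {q | q.1 = 0} (by
    rintro ⟨i, j'⟩
    constructor
    · rintro (rfl : i = 0)
      simp [hint']
    · intro hq
      have hσ : σ (i, j') = σ (0, (σ (i, j')).2 - 1) := by
        rw [hint', sub_add_cancel]
        exact Prod.ext hq rfl
      exact congrArg Prod.fst (σ.injective hσ)) ⟨(0, 0), rfl⟩
  have : ((1 : Fin (n + 1)), (0 : ZMod p)) ∈ {q : Fin (n + 1) × ZMod p | q.1 = 0} := by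
    rw [huniv]; trivial
  exact fin_add_one_ne hn 0 (by simpa using this)

/-- Layer `i` is left only from `a - 1`, and layer `i'` can be reached from outside only from layer
`i`. So exactly one node of layer `i'` is not preceded within its own layer. -/
theorem UsesLayerArcs.exists_entersAt_succ {σ : Equiv.Perm (Fin (n + 1) × ZMod p)}
    (h : UsesLayerArcs σ) {i i' : Fin (n + 1)} (hi : (i' : ℕ) = i + 1) {a : ZMod p}
    (ha : EntersAt σ i a) :
    ∃ b, EntersAt σ i' b ∧ σ (i, a - 1) = (i', b) ∧ (2 * a - b).val ≤ 2 := by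
  have hne : i ≠ i' := fun h' => by rw [h'] at hi; omega
  have hout : σ (i, a - 1) ≠ (i, a - 1 + 1) := fun h' => (ha _).1 h' (sub_add_cancel _ _)
  have hlast : i ≠ Fin.last n := fun h' => by
    have := i'.2
    simp [h'] at hi; omega
  rcases h (i, a - 1) with h1 | ⟨h1, h2⟩ | h1
  · exact absurd h1 hout
  · have hi' : (σ (i, a - 1)).1 = i' := Fin.ext (by rw [h1, hi])
    have hσ : σ (i, a - 1) = (i', (σ (i, a - 1)).2) := Prod.ext hi' rfl
    refine ⟨(σ (i, a - 1)).2, fun j => ⟨fun hj hjb => ?_, fun hj => ?_⟩, hσ, by simpa using h2⟩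
    · rw [hjb, ← hσ] at hj
      exact hne (congrArg Prod.fst (σ.injective hj)).symm
    · obtain ⟨⟨l, j'⟩, hq⟩ := σ.surjective (i', j + 1)
      have hpred := h (l, j')
      rw [hq] at hpred
      rcases hpred with h3 | ⟨h3, -⟩ | ⟨-, h3⟩
      · simp only [Prod.mk.injEq, add_left_inj] at h3
        obtain ⟨rfl, rfl⟩ := h3
        exact hq
      · obtain rfl : l = i := Fin.ext (by simp only at h3; omega)
        by_cases hj' : j' + 1 = a
        · obtain rfl : j' = a - 1 := eq_sub_of_add_eq hj'
          rw [hq] at hj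
          exact absurd rfl hj
        · have := (ha j').2 hj'
          rw [hq] at this
          exact absurd (congrArg Prod.fst this).symm hne
      · have := congrArg (fun q : Fin (n + 1) × ZMod p => (q.1 : ℕ)) h3
        simp only [Fin.val_zero] at this
        omega
  · exact absurd h1.1 hlast

theorem UsesLayerArcs.exists_isState {σ : Equiv.Perm (Fin (n + 1) × ZMod p)} (hn : 1 ≤ n)
    (h : UsesLayerArcs σ)
    (hconn : ∀ S : Set (Fin (n + 1) × ZMod p), (∀ q, q ∈ S ↔ σ q ∈ S) → S.Nonempty →
      S = Set.univ) : ∃ θ : ℕ → ZMod p, IsState n θ ∧ ⇑σ = layerSucc n θ := by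
  have hex : ∀ i : Fin (n + 1), ∃ a, EntersAt σ i a := by
    intro i
    induction i using Fin.induction with
    | zero => exact ⟨0, h.entersAt_zero hn hconn⟩
    | succ i ih =>
      obtain ⟨a, ha⟩ := ih
      obtain ⟨b, hb, -⟩ := h.exists_entersAt_succ (i' := i.succ) (by simp) ha
      exact ⟨b, hb⟩
  choose t ht using hex
  let θ : ℕ → ZMod p := fun m => t (Fin.ofNat (n + 1) m)
  have hθ : ∀ i : Fin (n + 1), θ i = t i := fun i => by simp [θ]
  have hnext : ∀ i i' : Fin (n + 1), (i' : ℕ) = i + 1 →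
      σ (i, θ i - 1) = (i', θ i') ∧ (2 * θ i - θ i').val ≤ 2 := fun i i' hi => by
    obtain ⟨b, hb, h1, h2⟩ := h.exists_entersAt_succ hi (ht i)
    obtain rfl := (ht i').eq hb
    rw [hθ, hθ]
    exact ⟨h1, h2⟩
  have h0 : θ 0 = 0 := (ht 0).eq (h.entersAt_zero hn hconn)
  refine ⟨θ, ⟨h0, fun i hi => ?_⟩, ?_⟩
  · exact (hnext ⟨i, by omega⟩ ⟨i + 1, by omega⟩ rfl).2
  · funext ⟨i, j⟩
    by_cases hj : j + 1 = θ i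
    · rw [layerSucc_of_eq hj]
      obtain rfl : j = θ i - 1 := eq_sub_of_add_eq hj
      by_cases hi : (i : ℕ) < n
      · exact (hnext i (i + 1) (val_add_one_of_val_lt hi)).1
      · obtain rfl : i = Fin.last n := Fin.ext (by have := i.2; simp; omega)
        rw [Fin.last_add_one, Fin.val_zero, h0]
        rcases h (Fin.last n, θ (Fin.last n : ℕ) - 1) with h1 | ⟨h1, -⟩ | h1
        · exact absurd ((hθ (Fin.last n)) ▸ hj) ((ht (Fin.last n) _).1 h1)
        · have := (σ (Fin.last n, θ (Fin.last n : ℕ) - 1)).1.2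
          simp only [Fin.val_last] at h1 this
          omega
        · exact h1.2
    · rw [layerSucc_of_ne hj]
      exact (ht i j).2 (hθ i ▸ hj)

end Layers

end TSP

namespace TSP

open Finset

/-! ### The gear counter: integer phases and improving moves. -/

section Counter

variable {n p : ℕ}

/-- The integer phase of gear `i` in the state `θ`. -/
def phase (θ : ℕ → ZMod p) : ℕ → ℤ
  | 0 => 0
  | i + 1 => 2 * phase θ i - lag θ i

theorem cast_phase [NeZero p] {θ : ℕ → ZMod p} (h0 : θ 0 = 0) (i : ℕ) :
    (phase θ i : ZMod p) = θ i := by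
  induction i with
  | zero => simp [phase, h0]
  | succ i ih => simp [phase, lag, ih]

/-- Changing the residues of at most `k` gears changes the integer phases by a bounded amount. -/
theorem abs_phase_sub_le [NeZero p] {k : ℕ} (hp : 2 ^ (k + 2) ≤ p) {θ θ' : ℕ → ZMod p}
    (hθ : IsState n θ) (hθ' : IsState n θ')
    (hk : ((range (n + 1)).filter fun i => θ i ≠ θ' i).card ≤ k) {m : ℕ} (hm : m ≤ n) :
    |phase θ' m - phase θ m| ≤ 2 ^ (((range (m + 1)).filter fun i => θ i ≠ θ' i).card + 1) - 2 := by
  induction m with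
  | zero => simp [phase, hθ.1, hθ'.1, filter_singleton]
  | succ m ih =>
    have ih := ih (by omega)
    have hstep : |phase θ' (m + 1) - phase θ (m + 1)| ≤ 2 * |phase θ' m - phase θ m| + 2 := by
      have h1 := hθ.2 m (by omega)
      have h2 := hθ'.2 m (by omega)
      simp only [phase]
      rw [abs_le]
      have h3 := abs_le.1 (le_refl |phase θ' m - phase θ m|)
      constructor <;> linarith [h3.1, h3.2]
    rw [range_add_one (n := m + 1), filter_insert]
    split_ifs with h
    · rw [card_insert_of_notMem (by simp), pow_succ]
      linarith
    · have hcard : ((range (m + 1)).filter fun i => θ i ≠ θ' i).card ≤ k :=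
        (card_le_card (filter_subset_filter _ (range_subset_range.2 (by omega)))).trans hk
      have hpow : (2 : ℤ) ^ (((range (m + 1)).filter fun i => θ i ≠ θ' i).card + 1) ≤
          2 ^ (k + 1) := pow_le_pow_right₀ (by norm_num) (by omega)
      have hp' : (2 : ℤ) ^ (k + 2) ≤ p := by exact_mod_cast hp
      rw [pow_succ] at hp'
      -- Equal residues make the difference a multiple of `p`, and its absolute value is at most `2
      -- ^ (k + 2) - 2 < p`.
      have hzero : phase θ' (m + 1) - phase θ (m + 1) = 0 := by
        refine Int.eq_zero_of_abs_lt_dvd (m := p) ?_ (by linarith)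
        rw [← ZMod.intCast_zmod_eq_zero_iff_dvd, Int.cast_sub, cast_phase hθ'.1, cast_phase hθ.1,
          sub_eq_zero]
        exact (not_not.1 h).symm
      rw [hzero, abs_zero]
      exact (abs_nonneg _).trans ih

/-- The state in which only the first gear has to move. -/
def startState (p : ℕ) : ℕ → ZMod p
  | 0 => 0
  | i + 1 => -2 ^ (i + 1)

theorem lag_startState_zero (hp : 3 ≤ p) : lag (startState p) 0 = 2 := by
  have h : (2 * startState p 0 - startState p (0 + 1)) = ((2 : ℕ) : ZMod p) := by
    simp [startState]
  rw [lag, h, ZMod.val_natCast, Nat.mod_eq_of_lt (by omega)]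

theorem lag_startState_succ (i : ℕ) : lag (startState p) (i + 1) = 0 := by
  rw [lag]
  simp [startState, pow_succ, mul_comm]

theorem isState_startState (hp : 3 ≤ p) : IsState n (startState p) := by
  refine ⟨rfl, fun i _ => ?_⟩
  cases i with
  | zero => rw [lag_startState_zero hp]
  | succ i => simp [lag_startState_succ]

theorem phase_startState (hp : 3 ≤ p) (i : ℕ) : phase (startState p) (i + 1) = -2 ^ (i + 1) := by
  induction i with
  | zero => simp [phase, lag_startState_zero hp]
  | succ i ih => rw [phase, ih, lag_startState_succ]; push_cast; ring

theorem energy_startState (hp : 3 ≤ p) (hn : 1 ≤ n) : energy n (startState p) = 2 * 3 ^ n := by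
  rw [energy, sum_eq_single 0, lag_startState_zero hp]
  · push_cast
    rw [Nat.sub_zero, mul_comm]
  · intro i _ hi
    obtain ⟨i, rfl⟩ := Nat.exists_eq_succ_of_ne_zero hi
    simp [lag_startState_succ]
  · intro h
    exact absurd (mem_range.2 hn) h

theorem phase_eq_zero {θ : ℕ → ZMod p} (h : ∀ i < n, lag θ i = 0) : phase θ n = 0 := by
  have : ∀ m ≤ n, phase θ m = 0 := fun m => by
    induction m with
    | zero => simp [phase]
    | succ m ih =>
      intro hm
      rw [phase, ih (by omega), h m (by omega)]
      simp
  exact this n le_rfl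

/-- A gear may be advanced if it is behind and the next one is not. -/
theorem isState_update (hp : 3 ≤ p) {θ : ℕ → ZMod p} (hθ : IsState n θ) {i : ℕ} (hi : i < n)
    (hlag : lag θ i ≠ 0) (hnext : ∀ j, i < j → j < n → lag θ j = 0) :
    IsState n (Function.update θ (i + 1) (θ (i + 1) + 1)) ∧
      energy n (Function.update θ (i + 1) (θ (i + 1) + 1)) < energy n θ := by
  have : Fact (1 < p) := ⟨by omega⟩
  set θ' := Function.update θ (i + 1) (θ (i + 1) + 1) with hdef
  have hlag_i : lag θ' i + 1 = lag θ i := by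
    have h1 : 2 * θ' i - θ' (i + 1) = (2 * θ i - θ (i + 1)) - 1 := by
      simp [hdef]; ring
    have h2 : (1 : ZMod p).val = 1 := ZMod.val_one p
    rw [lag] at hlag ⊢
    rw [h1, ZMod.val_sub (by rw [h2]; omega), h2]
    rw [lag]
    omega
  -- Advancing gear `i + 1` moves the target of the next gear by 2, so a lag of 0 becomes exactly
  -- the permitted 2.
  have hlag_s : i + 1 < n → lag θ' (i + 1) = 2 ∧ lag θ (i + 1) = 0 := fun h => by
    have h0 := hnext (i + 1) (by omega) h
    have h1 : 2 * θ (i + 1) - θ (i + 1 + 1) = 0 := (ZMod.val_eq_zero _).1 h0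
    have h2 : 2 * θ' (i + 1) - θ' (i + 1 + 1) = ((2 : ℕ) : ZMod p) := by
      have h3 : θ' (i + 1 + 1) = θ (i + 1 + 1) := by simp [hdef]
      have h4 : θ' (i + 1) = θ (i + 1) + 1 := by simp [hdef]
      rw [h3, h4]
      linear_combination h1
    exact ⟨by rw [lag, h2, ZMod.val_natCast, Nat.mod_eq_of_lt (by omega)], h0⟩
  have hlag_o : ∀ j, j ≠ i → j ≠ i + 1 → lag θ' j = lag θ j := fun j h1 h2 => by
    have h3 : j + 1 ≠ i + 1 := by omega
    simp [lag, hdef, h2, h1]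
  refine ⟨⟨by simp [hdef, hθ.1], fun j hj => ?_⟩, ?_⟩
  · have h := hθ.2 j hj
    by_cases h1 : j = i
    · subst h1; omega
    by_cases h2 : j = i + 1
    · subst h2; exact (hlag_s hj).1.le
    rwa [hlag_o j h1 h2]
  · have hterm : ∀ j ∈ range n, (3 : ℝ) ^ (n - j) * (lag θ' j : ℝ) = 3 ^ (n - j) * (lag θ j : ℝ) +
        ((if j = i then -3 ^ (n - i) else 0) + if j = i + 1 then 2 * 3 ^ (n - (i + 1)) else 0) := by
      intro j hj
      rw [mem_range] at hj
      by_cases h1 : j = i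
      · subst h1
        rw [← hlag_i]
        simp
        ring
      by_cases h2 : j = i + 1
      · subst h2
        obtain ⟨h3, h4⟩ := hlag_s hj
        rw [h3, h4]
        simp [mul_comm]
      · simp [hlag_o j h1 h2, h1, h2]
    rw [energy, energy, sum_congr rfl hterm, sum_add_distrib, sum_add_distrib, sum_ite_eq',
      sum_ite_eq', if_pos (mem_range.2 hi)]
    -- Base 3 makes the move improving: one unit of lag at weight `3 ^ (n - i)` outweighs two at a
    -- third of it.
    have hpow : (3 : ℝ) ^ (n - i) = 3 * 3 ^ (n - (i + 1)) := by
      rw [← pow_succ']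
      congr 1
      omega
    have hpos : (0 : ℝ) < 3 ^ (n - (i + 1)) := by positivity
    split_ifs <;> linarith

end Counter

/-! ### Transfer of the counter to TSP tours. -/

section Instance

variable {n p N : ℕ} [NeZero p] (hp : 3 ≤ p)
  (e : (Fin (n + 1) × ZMod p) ⊕ (Fin (n + 1) × ZMod p) ≃ Fin N)

/-- The weight of the edges that no relevant tour uses. -/
noncomputable def heavy (n : ℕ) : ℝ := 2 * 3 ^ n + 1

theorem heavy_nonneg (n : ℕ) : 0 ≤ heavy n := by
  unfold heavy
  positivity

/-- The TSP instance that simulates the counter. -/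
noncomputable def counterInst : Inst := ⟨N, arcWeight e (arcCost (heavy n)) (heavy n)⟩

/-- The tour that represents a state of the counter. -/
def stateTour (θ : ℕ → ZMod p) : Tour N :=
  ⟨succEdges e (layerSucc n θ), isTour_layerSucc (by omega) e θ⟩

theorem tourWeight_stateTour (hn : 1 ≤ n) {θ : ℕ → ZMod p} (hθ : IsState n θ) :
    (counterInst e).tourWeight (stateTour hp e θ) =
      -heavy n * Fintype.card (Fin (n + 1) × ZMod p) + energy n θ := by
  rw [← sum_arcCost_layerSucc hn (by omega) (heavy n) hθ,
    ← sum_arcWeight_succEdges e (arcCost_self _) (layerSucc_ne hn (by omega) θ)]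
  rfl

theorem exists_state_of_tourWeight_lt (hn : 1 ≤ n) {τ : Tour N}
    (hτ : (counterInst e).tourWeight τ <
      -heavy n * Fintype.card (Fin (n + 1) × ZMod p) + heavy n) :
    ∃ θ, IsState n θ ∧ τ = stateTour hp e θ := by
  obtain ⟨σ, hT, hne, hlt, hconn⟩ := τ.2.exists_perm_of_sum_lt e (heavy_nonneg n)
    (arcCost_self _) (fun q r h => arcCost_nonneg (heavy_nonneg n) h) hτ
  have harcs : UsesLayerArcs σ := fun q => arc_of_arcCost_lt (hne q) (hlt q)
  obtain ⟨θ, hθ, hσ⟩ := harcs.exists_isState hn hconn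
  exact ⟨θ, hθ, Subtype.ext (by rw [hT, hσ]; rfl)⟩

/-- If gear `i` changes, the new cycle omits the arc into `θ' i` inside layer `i`, which the old
cycle uses. Arcs of different layers are different edges. -/
theorem card_filter_ne_le (hn : 1 ≤ n) (θ θ' : ℕ → ZMod p) :
    ((range (n + 1)).filter fun i => θ i ≠ θ' i).card ≤
      ((stateTour hp e θ).1 \ (stateTour hp e θ').1).card := by
  have : Fact (1 < p) := ⟨by omega⟩
  have hval : ∀ i < n + 1, ((Fin.ofNat (n + 1) i : Fin (n + 1)) : ℕ) = i := fun i hi =>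
    Nat.mod_eq_of_lt hi
  refine card_le_card_of_injOn
    (fun i => arcEdge e (Fin.ofNat (n + 1) i, θ' i - 1) (Fin.ofNat (n + 1) i, θ' i)) ?_ ?_
  · intro i hi
    simp only [coe_filter, mem_range, Set.mem_ofPred_eq] at hi
    have hi' := hval i hi.1
    rw [mem_coe, mem_sdiff, stateTour, stateTour, arcEdge_mem_succEdges, arcEdge_mem_succEdges,
      layerSucc_of_ne (by rw [hi', sub_add_cancel]; exact hi.2.symm),
      layerSucc_of_eq (by rw [hi', sub_add_cancel])]
    refine ⟨Or.inr (by rw [sub_add_cancel]), ?_⟩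
    rintro (h | h)
    · have := congrArg Prod.snd h
      exact one_ne_zero (sub_eq_self.1 this.symm)
    · exact fin_add_one_ne hn _ (congrArg Prod.fst h).symm
  · intro i hi j hj hij
    simp only [coe_filter, mem_range, Set.mem_ofPred_eq] at hi hj
    have := congrArg (fun q : Fin (n + 1) × ZMod p => (q.1 : ℕ)) ((arcEdge_inj e).1 hij).1
    simpa only [hval i hi.1, hval j hj.1] using this

/-- Only three nodes can change successor: the last node visited in layer `i`, and the old and new
last nodes of layer `i + 1`. -/
theorem card_sdiff_update_le (θ : ℕ → ZMod p) {i : ℕ} (hi : i < n) (a : ZMod p) :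
    ((stateTour hp e θ).1 \ (stateTour hp e (Function.update θ (i + 1) a)).1).card ≤ 3 := by
  set θ' := Function.update θ (i + 1) a with hdef
  let D : Finset (Fin (n + 1) × ZMod p) := {(⟨i, by omega⟩, θ i - 1),
    (⟨i + 1, by omega⟩, θ (i + 1) - 1), (⟨i + 1, by omega⟩, a - 1)}
  have hsub : (stateTour hp e θ).1 \ (stateTour hp e θ').1 ⊆
      D.image fun q => arcEdge e q (layerSucc n θ q) := by
    intro x hx
    simp only [stateTour, succEdges, mem_sdiff, mem_union, mem_image, mem_univ, true_and,
      not_or] at hx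
    obtain ⟨hx1 | ⟨⟨l, j⟩, rfl⟩, hx2, hx3⟩ := hx
    · exact absurd hx1 hx2
    refine mem_image.2 ⟨(l, j), ?_, rfl⟩
    by_contra hD
    simp only [D, mem_insert, mem_singleton, Prod.mk.injEq, not_or, not_and, eq_sub_iff_add_eq,
      Fin.ext_iff] at hD
    refine hx3 ⟨(l, j), ?_⟩
    congr 1
    by_cases hl : (l : ℕ) = i + 1
    · rw [layerSucc_of_ne (by rw [hl, hdef, Function.update_self]; exact hD.2.2 hl),
        layerSucc_of_ne (by rw [hl]; exact hD.2.1 hl)]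
    · have hθl : θ' l = θ l := by simp [hdef, hl]
      by_cases hj : j + 1 = θ l
      · rw [layerSucc_of_eq hj, layerSucc_of_eq (hj.trans hθl.symm)]
        have hl' : ((l + 1 : Fin (n + 1)) : ℕ) ≠ i + 1 := fun h => by
          rw [Fin.val_add_one] at h
          split_ifs at h
          exact hD.1 (by omega) (by rw [hj]; congr 1; omega)
        simp [hdef, hl']
      · rw [layerSucc_of_ne hj, layerSucc_of_ne (by rwa [hθl])]
  exact (card_le_card hsub).trans (card_image_le.trans card_le_three)

theorem isKSwap_of_card_sdiff_le {k : ℕ} {τ τ' : Tour N} (h : (τ.1 \ τ'.1).card ≤ k) :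
    IsKSwap k τ τ' := by
  refine ⟨τ.1 \ τ'.1, τ'.1 \ τ.1, sdiff_subset, sdiff_subset.trans τ'.2.subset_edgeFinset,
    card_sdiff_comm (τ.2.card_eq.trans τ'.2.card_eq.symm), h, ?_⟩
  ext x
  simp only [mem_union, mem_sdiff]
  tauto

theorem IsKSwap.card_sdiff_le {k : ℕ} {τ τ' : Tour N} (h : IsKSwap k τ τ') :
    (τ.1 \ τ'.1).card ≤ k := by
  obtain ⟨E₁, E₂, -, -, -, hk, hτ'⟩ := h
  refine (card_le_card fun x hx => ?_).trans hk
  rw [hτ', mem_sdiff, mem_union, mem_sdiff] at hx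
  tauto

theorem exists_state_of_step (hn : 1 ≤ n) {k : ℕ} (hpk : 2 ^ (k + 2) ≤ p) {θ : ℕ → ZMod p} (hθ : IsState n θ)
    (hlt : energy n θ < heavy n) {τ : Tour N}
    (hstep : (kOpt k).Step (counterInst e) (stateTour hp e θ) τ) :
    ∃ θ', IsState n θ' ∧ energy n θ' < heavy n ∧ τ = stateTour hp e θ' ∧
      phase θ' n ≤ phase θ n + 2 ^ (k + 1) := by
  obtain ⟨⟨hswap, -⟩, hless⟩ := hstep
  replace hless : (counterInst e).tourWeight τ < (counterInst e).tourWeight (stateTour hp e θ) :=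
    hless
  rw [tourWeight_stateTour hp e hn hθ] at hless
  obtain ⟨θ', hθ', rfl⟩ := exists_state_of_tourWeight_lt hp e hn (hless.trans (by linarith))
  replace hless := (tourWeight_stateTour hp e hn hθ').ge.trans_lt hless
  have hk := (card_filter_ne_le hp e hn θ θ').trans (IsKSwap.card_sdiff_le hswap)
  refine ⟨θ', hθ', by linarith, rfl, ?_⟩
  have habs := (abs_le.1 (abs_phase_sub_le hpk hθ hθ' hk le_rfl)).2
  have hpow : (2 : ℤ) ^ (((range (n + 1)).filter fun i => θ i ≠ θ' i).card + 1) ≤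
      2 ^ (k + 1) := pow_le_pow_right₀ (by norm_num) (by omega)
  linarith

theorem phase_eq_zero_of_isLocalOpt (hn : 1 ≤ n) {k : ℕ} (hk : 3 ≤ k) {θ : ℕ → ZMod p} (hθ : IsState n θ)
    (hopt : (kOpt k).IsLocalOpt (counterInst e) (stateTour hp e θ)) : phase θ n = 0 := by
  refine phase_eq_zero (n := n) fun i hi => ?_
  by_contra hlag
  let s := (range n).filter fun i => lag θ i ≠ 0
  have hs : s.Nonempty := ⟨i, by simp [s, hi, hlag]⟩
  -- At the last nonzero lag all later lags vanish, as `isState_update` requires.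
  have hmax := s.max'_mem hs
  simp only [s, mem_filter, mem_range] at hmax
  obtain ⟨hstate, henergy⟩ := isState_update hp hθ hmax.1 hmax.2 fun j hj hjn => by
    by_contra h
    exact absurd (s.le_max' j (by simp [s, hjn, h])) (not_le.2 hj)
  have hless := henergy
  rw [← add_lt_add_iff_left (-heavy n * Fintype.card (Fin (n + 1) × ZMod p)),
    ← tourWeight_stateTour hp e hn hstate, ← tourWeight_stateTour hp e hn hθ] at hless
  have hswap : IsKSwap k (stateTour hp e θ)
      (stateTour hp e (Function.update θ (s.max' hs + 1) (θ (s.max' hs + 1) + 1))) :=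
    isKSwap_of_card_sdiff_le ((card_sdiff_update_le hp e θ hmax.1 _).trans hk)
  exact absurd hless (not_lt.2 (hopt _ ⟨hswap, hless⟩))

theorem two_pow_le_of_isExecution (hn : 1 ≤ n) {k : ℕ} (hk : 3 ≤ k) (hpk : 2 ^ (k + 2) ≤ p) {ℓ : ℕ}
    {P : ℕ → Tour N}
    (hP : (kOpt k).IsExecution (counterInst e) (stateTour hp e (startState p)) ℓ P) :
    2 ^ n ≤ ℓ * 2 ^ (k + 1) := by
  have key : ∀ i ≤ ℓ, ∃ θ, IsState n θ ∧ energy n θ < heavy n ∧ P i = stateTour hp e θ ∧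
      phase θ n ≤ -2 ^ n + i * 2 ^ (k + 1) := by
    intro i
    induction i with
    | zero =>
      refine fun _ => ⟨startState p, isState_startState hp, ?_, hP.start, ?_⟩
      · rw [energy_startState hp hn, heavy]
        linarith
      · obtain ⟨m, rfl⟩ : ∃ m, n = m + 1 := ⟨n - 1, by omega⟩
        rw [phase_startState hp]
        simp
    | succ i ih =>
      intro hi
      obtain ⟨θ, hθ, hlt, hPi, hphase⟩ := ih (by omega)
      have hstep := hP.step i (by omega)
      rw [hPi] at hstep
      obtain ⟨θ', hθ', hlt', hPi', hphase'⟩ := exists_state_of_step hp e hn hpk hθ hlt hstep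
      refine ⟨θ', hθ', hlt', hPi', ?_⟩
      push_cast
      linarith
  obtain ⟨θ, hθ, -, hPℓ, hphase⟩ := key ℓ le_rfl
  have hopt := hP.stop_localOpt
  rw [hPℓ] at hopt
  rw [phase_eq_zero_of_isLocalOpt hp e hn hk hθ hopt] at hphase
  have : (2 : ℤ) ^ n ≤ ℓ * 2 ^ (k + 1) := by linarith
  exact_mod_cast this

end Instance

end TSP

/-! ### Choice of the constants. -/

theorem mainTheorem4 (k : ℕ) (hk : 5 ≤ k) : (TSP.kOpt k).AllExp := by
  obtain ⟨p, hpk⟩ : ∃ p, p = 2 ^ (k + 2) := ⟨_, rfl⟩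
  have hp : 3 ≤ p := by
    have : k + 2 < 2 ^ (k + 2) := Nat.lt_two_pow_self
    omega
  have : NeZero p := ⟨by omega⟩
  have hp0 : (0 : ℝ) < 2 * p := by
    have : (0 : ℝ) < p := by exact_mod_cast NeZero.pos p
    linarith
  -- With `2 * p * (n + 1)` vertices, this base raised to the size is `2 ^ (n + 1)`; the factor `1 /
  -- 2 ^ (k + 2)` turns that into the bound `2 ^ n / 2 ^ (k + 1)`.
  refine ⟨2 ^ (1 / (2 * p : ℝ)), Real.one_lt_rpow (by norm_num) (by positivity),
    1 / 2 ^ (k + 2), by positivity, fun N => ?_⟩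
  let n := N + 1
  have hcard : Fintype.card ((Fin (n + 1) × ZMod p) ⊕ (Fin (n + 1) × ZMod p)) =
      2 * p * (n + 1) := by
    rw [Fintype.card_sum, TSP.card_layers]
    ring
  let e := Fintype.equivFinOfCardEq hcard
  have hn : 1 ≤ n := by omega
  refine ⟨TSP.counterInst e, ?_, TSP.stateTour hp e (TSP.startState p), fun ℓ P hP => ?_⟩
  · change N ≤ 2 * p * (n + 1)
    exact (show N ≤ n + 1 by omega).trans (Nat.le_mul_of_pos_left _ (by omega))
  · have hℓ := TSP.two_pow_le_of_isExecution hp e hn (by omega) hpk.ge hP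
    have hℓ' : (2 : ℝ) ^ n ≤ ℓ * 2 ^ (k + 1) := by exact_mod_cast hℓ
    change 1 / 2 ^ (k + 2) * ((2 : ℝ) ^ (1 / (2 * p : ℝ))) ^ (2 * p * (n + 1)) ≤ ℓ
    have hpow : ((2 : ℝ) ^ (1 / (2 * p : ℝ))) ^ (2 * p * (n + 1)) = 2 ^ (n + 1) := by
      rw [pow_mul, ← Real.rpow_natCast _ (2 * p), ← Real.rpow_mul (by norm_num)]
      push_cast
      rw [one_div_mul_cancel hp0.ne', Real.rpow_one]
    rw [hpow, one_div, inv_mul_le_iff₀ (by positivity), pow_succ, pow_succ 2 (k + 1)]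
    linarith
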